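/- **Theorem 1 (Impossibility).** Consider the linear system $x(t+1)=Ax(t)+w(t)$, $y(t)=Cx(t)+v(t)+a(t)$, $t\in\mathbb N$, with state $x(t)\in\mathbb R^n$, $p$ sensors and attack $a(t)\in\mathbb R^p$. Here $w(t)\sim\mathcal N(0,\sigma_w^2 I_n)$ and $v(t)\sim\mathcal N(0,\sigma_v^2 I_p)$ are i.i.d. over time ($\sigma_w\ge 0$, $\sigma_v>0$), $x(0)\sim\mathcal N(m_0,P_0)$, and $x(0)$, the process $w$ and the process $v$ are mutually independent. Let $0\le k\le p$. A $k$-adversary attacks a fixed set $\kappa\subseteq\{1,\dots,p\}$ of sensors with $|\kappa|=k$: $a_j(t)=0$ for all $j\notin\kappa$ and all $t$, while for $j\in\kappa$ it observes the true outputs and changes them arbitrarily, subject to causality: its knowledge up to time $t$, which determines $a(t)$, is independent of $\{w(t')\}_{t'>t}$ and, for each $i\notin\kappa$, of $\{v_i(t')\}_{t'>t}$. For $s\subseteq\{1,\dots,p\}$ let $\hat x^\star_s(t)$ be the Kalman filter estimate of $x(t)$ (prediction version, initialized with mean $m_0$ and covariance $P_0$) from the attack-free outputs of the sensors in $s$ at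 times $0,\dots,t-1$. Let $P^\star_s(t)=\mathbb E\big[(x(t)-\hat x^\star_s(t))(x(t)-\hat x^\star_s(t))^T\big]$. Assume that for every $s$ with $|s|=p-k$ the filter has a steady-state error covariance $P^\star_s=\lim_{t\to\infty}P^\star_s(t)$, and let $$s_{\mathrm{worst},p-k}\in\arg\max_{|s|=p-k}\operatorname{tr}(P^\star_s).$$ Then there are a set $\kappa$ of $k$ sensors and an attack sequence $a(t)$ of a $k$-adversary on $\kappa$, under which the outputs of all attacked sensors are zero, with the following property. Let $e(t)=x(t)-\mathbb E[x(t)\mid y(0),\dots,y(t-1)]$ be the error of the oracle MMSE estimator, which knows $\kappa$. Then $$\operatorname{tr}\big(\mathbb E(e(t)e(t)^T)\big)\ \ge\ \operatorname{tr}\big(P^\star_{s_{\mathrm{worst},p-k}}\big)$$ at every time $t$ at which the Kalman filter for $s_{\mathrm{worst},p-k}$ is in steady state, i.e. $P^\star_{s_{\mathrm{worst},p-k}}(t)=P^\star_{s_{\mathrm{worst},p-k}}$. Moreover, whether or not it is ever exactly in steady state, the bound holds asymptotically: $\liminf_{t\to\infty}\operatorname{tr}\big(\mathbb E(e(t)e(t)^T)\big)\ge\operatorname{tr}\big(P^\star_{s_{\mathrm{worst},p-k}}\big)$.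 -/

import Mathlib

open MeasureTheory ProbabilityTheory Filter
open scoped Topology

noncomputable section

/-- Parameters of `x(t+1) = A x(t) + w(t)`, `y(t) = C x(t) + v(t)` with `n` states and `p` sensors:
`w(t) ~ N(0, σw² I)`, `v(t) ~ N(0, σv² I)` and `x(0) ~ N(m₀, P₀)`. -/
structure LinSys (n p : ℕ) where
  A : Matrix (Fin n) (Fin n) ℝ
  C : Matrix (Fin p) (Fin n) ℝ
  σw : ℝ
  σv : ℝ
  m₀ : EuclideanSpace ℝ (Fin n)
  P₀ : Matrix (Fin n) (Fin n) ℝ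

namespace LinSys

variable {n p : ℕ} {Ω : Type*} [mΩ : MeasurableSpace Ω]

/-- `x`, `w`, `v` are the state, process noise and sensor noise of the system `S` on `(Ω, μ)`:
the noises are i.i.d. Gaussian over time, and `x(0)`, the process `w` and the process `v` are
mutually independent. -/
structure IsRealization (S : LinSys n p) (μ : Measure Ω)
    (x w : ℕ → Ω → EuclideanSpace ℝ (Fin n)) (v : ℕ → Ω → EuclideanSpace ℝ (Fin p)) : Prop where
  measurable_init : Measurable (x 0)
  measurable_w : ∀ t, Measurable (w t)
  measurable_v : ∀ t, Measurable (v t)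
  law_init : HasLaw (x 0) (multivariateGaussian S.m₀ S.P₀) μ
  law_w : ∀ t, HasLaw (w t) (multivariateGaussian 0 (S.σw ^ 2 • 1)) μ
  law_v : ∀ t, HasLaw (v t) (multivariateGaussian 0 (S.σv ^ 2 • 1)) μ
  indep_w : iIndepFun w μ
  indep_v : iIndepFun v μ
  indep_wv : IndepFun (fun ω t => w t ω) (fun ω t => v t ω) μ
  indep_init : IndepFun (x 0) (fun ω => ((fun t => w t ω), (fun t => v t ω))) μ
  dynamics : ∀ t ω, x (t + 1) ω = S.A.toEuclideanLin (x t ω) + w t ω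

/-- The attack-free output `C x(t) + v(t)`. -/
def cleanOutput (S : LinSys n p) (x : ℕ → Ω → EuclideanSpace ℝ (Fin n))
    (v : ℕ → Ω → EuclideanSpace ℝ (Fin p)) (t : ℕ) (ω : Ω) : EuclideanSpace ℝ (Fin p) :=
  S.C.toEuclideanLin (x t ω) + v t ω

/-- The output `y(t) = C x(t) + v(t) + a(t)` under the attack `a`. -/
def output (S : LinSys n p) (x : ℕ → Ω → EuclideanSpace ℝ (Fin n))
    (v a : ℕ → Ω → EuclideanSpace ℝ (Fin p)) (t : ℕ) (ω : Ω) : EuclideanSpace ℝ (Fin p) :=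
  S.cleanOutput x v t ω + a t ω

/-- `a` is an attack by a `k`-adversary on the (time-independent) sensor set `κ`. The filtration
`𝒦` is the adversary's knowledge: it contains the true outputs of the attacked sensors, determines
the attack, and at time `t` is independent of the process noise after `t` and, for each sensor
outside `κ`, of its noise after `t`. -/
structure IsKAttack (S : LinSys n p) (μ : Measure Ω)
    (x w : ℕ → Ω → EuclideanSpace ℝ (Fin n)) (v : ℕ → Ω → EuclideanSpace ℝ (Fin p))
    (k : ℕ) (κ : Finset (Fin p)) (a : ℕ → Ω → EuclideanSpace ℝ (Fin p)) : Prop where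
  card_eq : κ.card = k
  attack_free : ∀ j ∉ κ, ∀ t ω, a t ω j = 0
  causal : ∃ 𝒦 : Filtration ℕ mΩ,
    (∀ t, Measurable[𝒦 t] (a t)) ∧
    (∀ j ∈ κ, ∀ t, Measurable[𝒦 t] (fun ω => S.cleanOutput x v t ω j)) ∧
    (∀ t, Indep (𝒦 t) (⨆ t' > t, MeasurableSpace.comap (w t') inferInstance) μ) ∧
    (∀ i ∉ κ, ∀ t,
      Indep (𝒦 t) (⨆ t' > t, MeasurableSpace.comap (fun ω => v t' ω i) inferInstance) μ)

/-- The rows of `C` indexed by `s`. -/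
def rows (S : LinSys n p) (s : Finset (Fin p)) : Matrix s (Fin n) ℝ :=
  S.C.submatrix (fun i => (i : Fin p)) id

/-- The Kalman (prediction) gain for the sensors `s` at prediction error covariance `P`. -/
def gain (S : LinSys n p) (s : Finset (Fin p)) (P : Matrix (Fin n) (Fin n) ℝ) :
    Matrix (Fin n) s ℝ :=
  S.A * P * (S.rows s).transpose *
    (S.rows s * P * (S.rows s).transpose + S.σv ^ 2 • (1 : Matrix s s ℝ))⁻¹

/-- The Riccati recursion of the prediction Kalman filter for the sensors `s`. -/
def riccati (S : LinSys n p) (s : Finset (Fin p)) : ℕ → Matrix (Fin n) (Fin n) ℝ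
  | 0 => S.P₀
  | t + 1 =>
    S.A * riccati S s t * S.A.transpose + S.σw ^ 2 • (1 : Matrix (Fin n) (Fin n) ℝ)
      - S.gain s (riccati S s t) * S.rows s * riccati S s t * S.A.transpose

/-- The Kalman filter (prediction version): the estimate at time `t` uses the outputs
`y(0), …, y(t-1)` of the sensors in `s`. -/
def kalman (S : LinSys n p) (s : Finset (Fin p)) (y : ℕ → Ω → EuclideanSpace ℝ (Fin p)) :
    ℕ → Ω → EuclideanSpace ℝ (Fin n)
  | 0, _ => S.m₀
  | t + 1, ω =>
    S.A.toEuclideanLin (kalman S s y t ω) +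
      (S.gain s (S.riccati s t)).toEuclideanLin
        (WithLp.toLp 2 (fun i : s => y t ω i) - (S.rows s).toEuclideanLin (kalman S s y t ω))

/-- The error covariance matrix `E (e eᵀ)`, `e = z - ẑ`, of the estimate `ẑ` of `z`. -/
def errCov (μ : Measure Ω) (z zhat : Ω → EuclideanSpace ℝ (Fin n)) :
    Matrix (Fin n) (Fin n) ℝ :=
  Matrix.of fun i j => ∫ ω, (z ω i - zhat ω i) * (z ω j - zhat ω j) ∂μ

/-- The error covariance at time `t` of the Kalman filter for `s` run on attack-free outputs. -/
def kalmanCov (S : LinSys n p) (μ : Measure Ω) (x : ℕ → Ω → EuclideanSpace ℝ (Fin n))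
    (v : ℕ → Ω → EuclideanSpace ℝ (Fin p)) (s : Finset (Fin p)) (t : ℕ) :
    Matrix (Fin n) (Fin n) ℝ :=
  errCov μ (x t) (S.kalman s (S.cleanOutput x v) t)

/-- `P` is the steady-state error covariance of the attack-free Kalman filter for `s`.
A filter whose error covariance is `P` at all times is a special case. -/
def IsSteadyStateCov (S : LinSys n p) (μ : Measure Ω) (x : ℕ → Ω → EuclideanSpace ℝ (Fin n))
    (v : ℕ → Ω → EuclideanSpace ℝ (Fin p)) (s : Finset (Fin p))
    (P : Matrix (Fin n) (Fin n) ℝ) : Prop :=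
  Tendsto (fun t => S.kalmanCov μ x v s t) atTop (𝓝 P)

/-- The oracle MMSE (prediction) estimate: the conditional expectation of `x(t)` given all
outputs `y(0), …, y(t-1)`. The attacked set and the attack are fixed in advance and enter
through the joint law of `x` and `y`, so the estimator has full knowledge of them. -/
def oracle (μ : Measure Ω) (x : ℕ → Ω → EuclideanSpace ℝ (Fin n))
    (y : ℕ → Ω → EuclideanSpace ℝ (Fin p)) (t : ℕ) : Ω → EuclideanSpace ℝ (Fin n) :=
  condExp (⨆ t' < t, MeasurableSpace.comap (y t') inferInstance) μ (x t)

end LinSys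

end

/-! Zeroing the outputs of the sensors outside `s` makes them worthless, so the oracle knows exactly
the history of the sensors in `s`. The error of the Kalman filter for `s` is Gaussian and
uncorrelated with the innovation, because the gain solves the normal equation of the linear
regression on the innovation. Hence the error is independent of all outputs of `s` so far, the
Kalman estimate is the conditional expectation of the state, and the oracle has the error
covariance of the Kalman filter at every time. For a worst-case set `s` of `p - k` sensors both
bounds follow at once. -/

section Independence

variable {Ω ι κ : Type*} {m m₁ m₂ m₃ mΩ : MeasurableSpace Ω} {μ : Measure Ω}

theorem isPiSystem_image2_inter {C D : Set (Set Ω)} (hC : IsPiSystem C) (hD : IsPiSystem D) :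
    IsPiSystem (Set.image2 (· ∩ ·) C D) := by
  rintro _ ⟨b, hb, c, hc, rfl⟩ _ ⟨b', hb', c', hc', rfl⟩ hne
  simp only [Set.inter_inter_inter_comm b c b' c'] at hne ⊢
  exact Set.mem_image2_of_mem (hC b hb b' hb' hne.left) (hD c hc c' hc' hne.right)

theorem sup_eq_generateFrom_image2_inter (m₁ m₂ : MeasurableSpace Ω) :
    m₁ ⊔ m₂ = MeasurableSpace.generateFrom
      (Set.image2 (· ∩ ·) {b | MeasurableSet[m₁] b} {c | MeasurableSet[m₂] c}) := by
  refine le_antisymm (sup_le (fun b hb => ?_) fun c hc => ?_) (MeasurableSpace.generateFrom_le ?_)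
  · exact MeasurableSpace.measurableSet_generateFrom
      ⟨b, hb, Set.univ, MeasurableSet.univ, Set.inter_univ b⟩
  · exact MeasurableSpace.measurableSet_generateFrom
      ⟨Set.univ, MeasurableSet.univ, c, hc, Set.univ_inter c⟩
  · rintro _ ⟨b, hb, c, hc, rfl⟩
    exact MeasurableSet.inter ((le_sup_left : m₁ ≤ m₁ ⊔ m₂) b hb)
      ((le_sup_right : m₂ ≤ m₁ ⊔ m₂) c hc)

theorem indep_sup_right_of_indep_sup_left [IsZeroOrProbabilityMeasure μ]
    (h₁ : m₁ ≤ mΩ) (h₂ : m₂ ≤ mΩ) (h₃ : m₃ ≤ mΩ)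
    (h₁₂ : Indep m₁ m₂ μ) (h : Indep (m₁ ⊔ m₂) m₃ μ) : Indep m₁ (m₂ ⊔ m₃) μ := by
  refine IndepSets.indep h₁ (sup_le h₂ h₃) (@MeasurableSpace.isPiSystem_measurableSet Ω m₁)
    (isPiSystem_image2_inter (@MeasurableSpace.isPiSystem_measurableSet Ω m₂)
      (@MeasurableSpace.isPiSystem_measurableSet Ω m₃))
    (@MeasurableSpace.generateFrom_measurableSet Ω m₁).symm
    (sup_eq_generateFrom_image2_inter m₂ m₃) ?_
  rw [Indep_iff] at h₁₂ h
  rw [IndepSets_iff]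
  rintro a _ ha ⟨b, hb, c, hc, rfl⟩
  have ha' : MeasurableSet[m₁ ⊔ m₂] a := (le_sup_left : m₁ ≤ m₁ ⊔ m₂) a ha
  have hb' : MeasurableSet[m₁ ⊔ m₂] b := (le_sup_right : m₂ ≤ m₁ ⊔ m₂) b hb
  rw [← Set.inter_assoc, h _ c (ha'.inter hb') hc, h₁₂ a b ha hb, h b c hb' hc, mul_assoc]

theorem iIndep_sumElim {m₁ : ι → MeasurableSpace Ω} {m₂ : κ → MeasurableSpace Ω}
    (h₁ : iIndep m₁ μ) (h₂ : iIndep m₂ μ) (h : Indep (⨆ i, m₁ i) (⨆ j, m₂ j) μ) :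
    iIndep (Sum.elim m₁ m₂) μ := by
  rw [iIndep_iff] at h₁ h₂ ⊢
  rw [Indep_iff] at h
  intro s f hf
  have hleft : ∀ i ∈ s.toLeft, MeasurableSet[m₁ i] (f (.inl i)) :=
    fun i hi => hf _ (Finset.mem_toLeft.mp hi)
  have hright : ∀ j ∈ s.toRight, MeasurableSet[m₂ j] (f (.inr j)) :=
    fun j hj => hf _ (Finset.mem_toRight.mp hj)
  have hsplit : ⋂ k ∈ s, f k =
      (⋂ i ∈ s.toLeft, f (.inl i)) ∩ ⋂ j ∈ s.toRight, f (.inr j) := by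
    ext ω
    simp [Sum.forall]
  rw [hsplit, Finset.prod_sum_eq_prod_toLeft_mul_prod_toRight, ← h₁ _ hleft, ← h₂ _ hright]
  exact h _ _
    (Finset.measurableSet_biInter _ fun i hi => le_iSup m₁ i _ (hleft i hi))
    (Finset.measurableSet_biInter _ fun j hj => le_iSup m₂ j _ (hright j hj))

theorem condExp_add_ae_eq_of_indep {E : Type*} [NormedAddCommGroup E] [NormedSpace ℝ E]
    [CompleteSpace E] [MeasurableSpace E] [BorelSpace E] [SecondCountableTopology E]
    [IsProbabilityMeasure μ] (hm : m ≤ mΩ) {X Y : Ω → E}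
    (hX : Measurable X) (hXint : Integrable X μ) (hX₀ : ∫ ω, X ω ∂μ = 0)
    (hXm : Indep (MeasurableSpace.comap X inferInstance) m μ)
    (hY : Measurable[m] Y) (hYint : Integrable Y μ) : μ[X + Y | m] =ᵐ[μ] Y := by
  have hcondX : μ[X | m] =ᵐ[μ] fun _ => 0 :=
    hX₀ ▸ condExp_indep_eq hX.comap_le hm (comap_measurable X).stronglyMeasurable hXm
  have hcondY : μ[Y | m] = Y := condExp_of_stronglyMeasurable hm hY.stronglyMeasurable hYint
  filter_upwards [condExp_add hXint hYint m, hcondX] with ω hadd hzero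
  rw [hadd, Pi.add_apply, hzero, hcondY, zero_add]

end Independence

section CrossCovariance

variable {Ω : Type*} [MeasurableSpace Ω] {μ : Measure Ω} {ι κ ν ρ : Type*}

/-- The cross-covariance matrix of two random vectors. -/
noncomputable def crossCov (μ : Measure Ω) (X : Ω → EuclideanSpace ℝ ι)
    (Y : Ω → EuclideanSpace ℝ κ) : Matrix ι κ ℝ :=
  Matrix.of fun i j => cov[fun ω => X ω i, fun ω => Y ω j; μ]

theorem crossCov_transpose (X : Ω → EuclideanSpace ℝ ι) (Y : Ω → EuclideanSpace ℝ κ) :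
    (crossCov μ X Y).transpose = crossCov μ Y X := by
  ext i j
  exact covariance_comm _ _

variable [Fintype ι] [Fintype κ] [Fintype ν]
  {X : Ω → EuclideanSpace ℝ ι} {Y : Ω → EuclideanSpace ℝ κ}

theorem crossCov_eq_of_hasLaw_multivariateGaussian [DecidableEq ι]
    {m : EuclideanSpace ℝ ι} {P : Matrix ι ι ℝ} (hP : P.PosSemidef)
    (hX : HasLaw X (multivariateGaussian m P) μ) : crossCov μ X X = P := by
  ext i j
  rw [← covariance_eval_multivariateGaussian (μ := m) hP i j, ← hX.map_eq,
    covariance_map (by fun_prop) (by fun_prop) hX.aemeasurable]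
  rfl

theorem crossCov_eq_zero_of_indepFun (hX : MemLp X 2 μ) (hY : MemLp Y 2 μ)
    (h : IndepFun X Y μ) : crossCov μ X Y = 0 := by
  ext i j
  have hij : IndepFun (fun ω => X ω i) (fun ω => Y ω j) μ :=
    h.comp (φ := fun x : EuclideanSpace ℝ ι => x i) (ψ := fun y : EuclideanSpace ℝ κ => y j)
      (by fun_prop) (by fun_prop)
  exact hij.covariance_eq_zero (hX.eval_piLp i) (hY.eval_piLp j)

theorem crossCov_sub_const_self [IsProbabilityMeasure μ] (hX : Integrable X μ)
    (c : EuclideanSpace ℝ ι) :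
    crossCov μ (fun ω => X ω - c) (fun ω => X ω - c) = crossCov μ X X := by
  ext i j
  simp only [crossCov, Matrix.of_apply, PiLp.sub_apply]
  rw [covariance_sub_const_left (hX.eval_piLp i), covariance_sub_const_right (hX.eval_piLp j)]

theorem measurable_toEuclideanLin [DecidableEq ι] (M : Matrix ν ι ℝ) :
    Measurable M.toEuclideanLin :=
  M.toEuclideanLin.toContinuousLinearMap.continuous.measurable

theorem memLp_toEuclideanLin [DecidableEq ι] (M : Matrix ν ι ℝ) {q : ENNReal} (hX : MemLp X q μ) :
    MemLp (fun ω => M.toEuclideanLin (X ω)) q μ :=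
  M.toEuclideanLin.toContinuousLinearMap.comp_memLp' hX

theorem integrable_toEuclideanLin [DecidableEq ι] (M : Matrix ν ι ℝ) (hX : Integrable X μ) :
    Integrable (fun ω => M.toEuclideanLin (X ω)) μ :=
  M.toEuclideanLin.toContinuousLinearMap.integrable_comp hX

theorem integral_toEuclideanLin [DecidableEq ι] (M : Matrix ν ι ℝ) (hX : Integrable X μ) :
    ∫ ω, M.toEuclideanLin (X ω) ∂μ = M.toEuclideanLin (∫ ω, X ω ∂μ) :=
  M.toEuclideanLin.toContinuousLinearMap.integral_comp_comm hX

variable [IsFiniteMeasure μ] {X' : Ω → EuclideanSpace ℝ ι}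

theorem crossCov_add_left (hX : MemLp X 2 μ) (hX' : MemLp X' 2 μ) (hY : MemLp Y 2 μ) :
    crossCov μ (fun ω => X ω + X' ω) Y = crossCov μ X Y + crossCov μ X' Y := by
  ext i j
  exact covariance_add_left (hX.eval_piLp i) (hX'.eval_piLp i) (hY.eval_piLp j)

theorem crossCov_sub_left (hX : MemLp X 2 μ) (hX' : MemLp X' 2 μ) (hY : MemLp Y 2 μ) :
    crossCov μ (fun ω => X ω - X' ω) Y = crossCov μ X Y - crossCov μ X' Y := by
  ext i j
  exact covariance_sub_left (hX.eval_piLp i) (hX'.eval_piLp i) (hY.eval_piLp j)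

theorem crossCov_add_right (hY : MemLp Y 2 μ) (hX : MemLp X 2 μ) (hX' : MemLp X' 2 μ) :
    crossCov μ Y (fun ω => X ω + X' ω) = crossCov μ Y X + crossCov μ Y X' := by
  rw [← crossCov_transpose, crossCov_add_left hX hX' hY, Matrix.transpose_add,
    crossCov_transpose, crossCov_transpose]

theorem crossCov_sub_right (hY : MemLp Y 2 μ) (hX : MemLp X 2 μ) (hX' : MemLp X' 2 μ) :
    crossCov μ Y (fun ω => X ω - X' ω) = crossCov μ Y X - crossCov μ Y X' := by
  rw [← crossCov_transpose, crossCov_sub_left hX hX' hY, Matrix.transpose_sub,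
    crossCov_transpose, crossCov_transpose]

theorem crossCov_toEuclideanLin_left [DecidableEq ι] (M : Matrix ρ ι ℝ)
    (hX : MemLp X 2 μ) (hY : MemLp Y 2 μ) :
    crossCov μ (fun ω => M.toEuclideanLin (X ω)) Y = M * crossCov μ X Y := by
  ext i j
  have hrow : (fun ω => M.toEuclideanLin (X ω) i) = fun ω => ∑ l, M i l * X ω l := by
    ext ω
    simp [Matrix.toLpLin_apply, Matrix.mulVec, dotProduct]
  simp only [crossCov, Matrix.of_apply, Matrix.mul_apply, hrow]
  rw [covariance_fun_sum_left (fun l => (hX.eval_piLp l).const_mul _) (hY.eval_piLp j)]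
  simp only [covariance_const_mul_left]

theorem crossCov_toEuclideanLin_right [DecidableEq ι] (M : Matrix ρ ι ℝ)
    (hY : MemLp Y 2 μ) (hX : MemLp X 2 μ) :
    crossCov μ Y (fun ω => M.toEuclideanLin (X ω)) = crossCov μ Y X * M.transpose := by
  rw [← crossCov_transpose, crossCov_toEuclideanLin_left M hX hY, Matrix.transpose_mul,
    crossCov_transpose]

theorem crossCov_toEuclideanLin_add_toEuclideanLin_add [DecidableEq ι]
    (M : Matrix κ ι ℝ) (N : Matrix ν ι ℝ) {Z : Ω → EuclideanSpace ℝ ν}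
    (hX : MemLp X 2 μ) (hY : MemLp Y 2 μ) (hZ : MemLp Z 2 μ)
    (hXY : crossCov μ X Y = 0) (hXZ : crossCov μ X Z = 0) :
    crossCov μ (fun ω => M.toEuclideanLin (X ω) + Y ω) (fun ω => N.toEuclideanLin (X ω) + Z ω) =
      M * crossCov μ X X * N.transpose + crossCov μ Y Z := by
  have hMX := memLp_toEuclideanLin M hX
  have hNX := memLp_toEuclideanLin N hX
  have hNXZ : MemLp (fun ω => N.toEuclideanLin (X ω) + Z ω) 2 μ := hNX.add hZ
  have hYX : crossCov μ Y X = 0 := by rw [← crossCov_transpose, hXY, Matrix.transpose_zero]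
  rw [crossCov_add_left hMX hY hNXZ, crossCov_add_right hMX hNX hZ,
    crossCov_add_right hY hNX hZ, crossCov_toEuclideanLin_left M hX hNX,
    crossCov_toEuclideanLin_right N hX hX, crossCov_toEuclideanLin_left M hX hZ,
    crossCov_toEuclideanLin_right N hY hX, hXZ, hYX, Matrix.mul_zero, Matrix.zero_mul,
    add_zero, zero_add, Matrix.mul_assoc]

theorem crossCov_self_posSemidef (hX : MemLp X 2 μ) : (crossCov μ X X).PosSemidef := by
  classical
  refine Matrix.PosSemidef.of_dotProduct_mulVec_nonneg ?_ fun y => ?_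
  · rw [Matrix.IsHermitian, Matrix.conjTranspose_eq_transpose_of_trivial, crossCov_transpose]
  · let M : Matrix Unit ι ℝ := Matrix.replicateRow Unit y
    have hvar : 0 ≤ crossCov μ (fun ω => M.toEuclideanLin (X ω))
        (fun ω => M.toEuclideanLin (X ω)) () () := by
      simp only [crossCov, Matrix.of_apply]
      rw [covariance_self ((memLp_toEuclideanLin M hX).eval_piLp ()).aemeasurable]
      exact variance_nonneg _ _
    rw [crossCov_toEuclideanLin_left M hX (memLp_toEuclideanLin M hX),
      crossCov_toEuclideanLin_right M hX hX] at hvar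
    simpa [M, Matrix.mul_apply, Matrix.mulVec, dotProduct] using hvar

end CrossCovariance

section Regression

variable {Ω : Type*} [MeasurableSpace Ω] {μ : Measure Ω} {ι κ : Type*} [Fintype ι] [Fintype κ]
  {X : Ω → EuclideanSpace ℝ ι} {Y : Ω → EuclideanSpace ℝ κ}

theorem indepFun_of_crossCov_eq_zero (hXY : HasGaussianLaw (fun ω => (X ω, Y ω)) μ)
    (h : crossCov μ X Y = 0) : IndepFun X Y μ := by
  let toPi := (PiLp.continuousLinearEquiv 2 ℝ fun _ : ι => ℝ).prodCongr
    (PiLp.continuousLinearEquiv 2 ℝ fun _ : κ => ℝ)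
  have hcoord : IndepFun (fun ω i => X ω i) (fun ω j => Y ω j) μ :=
    HasGaussianLaw.indepFun_of_covariance_eval (hXY.map_equiv toPi)
      fun i j => congrFun (congrFun h i) j
  exact hcoord.comp (WithLp.measurable_toLp 2 (ι → ℝ)) (WithLp.measurable_toLp 2 (κ → ℝ))

variable [DecidableEq κ] {K : Matrix ι κ ℝ}

theorem crossCov_sub_toEuclideanLin_eq_zero [IsFiniteMeasure μ]
    (hX : MemLp X 2 μ) (hY : MemLp Y 2 μ) (hK : K * crossCov μ Y Y = crossCov μ X Y) :
    crossCov μ (fun ω => X ω - K.toEuclideanLin (Y ω)) Y = 0 := by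
  rw [crossCov_sub_left hX (memLp_toEuclideanLin K hY) hY, crossCov_toEuclideanLin_left K hY hY,
    hK, sub_self]

theorem crossCov_sub_toEuclideanLin_self [IsFiniteMeasure μ]
    (hX : MemLp X 2 μ) (hY : MemLp Y 2 μ) (hK : K * crossCov μ Y Y = crossCov μ X Y) :
    crossCov μ (fun ω => X ω - K.toEuclideanLin (Y ω)) (fun ω => X ω - K.toEuclideanLin (Y ω)) =
      crossCov μ X X - K * crossCov μ Y X := by
  have hKY := memLp_toEuclideanLin K hY
  have hres : MemLp (fun ω => X ω - K.toEuclideanLin (Y ω)) 2 μ := hX.sub hKY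
  rw [crossCov_sub_right hres hX hKY, crossCov_toEuclideanLin_right K hres hY,
    crossCov_sub_toEuclideanLin_eq_zero hX hY hK, crossCov_sub_left hX hKY hX,
    crossCov_toEuclideanLin_left K hY hX, Matrix.zero_mul, sub_zero]

theorem hasGaussianLaw_sub_toEuclideanLin_prodMk (K : Matrix ι κ ℝ)
    (hXY : HasGaussianLaw (fun ω => (X ω, Y ω)) μ) :
    HasGaussianLaw (fun ω => (X ω - K.toEuclideanLin (Y ω), Y ω)) μ :=
  hXY.map_fun ((ContinuousLinearMap.fst ℝ (EuclideanSpace ℝ ι) (EuclideanSpace ℝ κ) -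
    K.toEuclideanLin.toContinuousLinearMap ∘L ContinuousLinearMap.snd ℝ _ _).prod
      (ContinuousLinearMap.snd ℝ _ _))

theorem indepFun_sub_toEuclideanLin (hXY : HasGaussianLaw (fun ω => (X ω, Y ω)) μ)
    (hK : K * crossCov μ Y Y = crossCov μ X Y) :
    IndepFun (fun ω => X ω - K.toEuclideanLin (Y ω)) Y μ := by
  have := hXY.isProbabilityMeasure
  exact indepFun_of_crossCov_eq_zero (hasGaussianLaw_sub_toEuclideanLin_prodMk K hXY)
    (crossCov_sub_toEuclideanLin_eq_zero hXY.fst.memLp_two hXY.snd.memLp_two hK)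

end Regression

section Gaussian

variable {Ω : Type*} [MeasurableSpace Ω] {μ : Measure Ω}

theorem hasGaussianLaw_sub_const {E : Type*} [NormedAddCommGroup E] [NormedSpace ℝ E]
    [MeasurableSpace E] [BorelSpace E] [SecondCountableTopology E] {X : Ω → E}
    (hX : HasGaussianLaw X μ) (c : E) : HasGaussianLaw (fun ω => X ω - c) μ := by
  have := hX.isGaussian_map
  have hmap : μ.map (fun ω => X ω - c) = (μ.map X).map fun z => z - c := by
    rw [AEMeasurable.map_map_of_aemeasurable (by fun_prop) hX.aemeasurable]
    rfl
  exact ⟨hmap ▸ inferInstance⟩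

theorem integral_eq_of_hasLaw_multivariateGaussian {ι : Type*} [Fintype ι] [DecidableEq ι]
    {X : Ω → EuclideanSpace ℝ ι} {m : EuclideanSpace ℝ ι} {P : Matrix ι ι ℝ}
    (hX : HasLaw X (multivariateGaussian m P) μ) : ∫ ω, X ω ∂μ = m :=
  hX.integral_eq.trans integral_id_multivariateGaussian

end Gaussian

namespace LinSys

section Filter

variable {n p : ℕ} {Ω : Type*} {S : LinSys n p} {s : Finset (Fin p)}
  {x w : ℕ → Ω → EuclideanSpace ℝ (Fin n)} {v y : ℕ → Ω → EuclideanSpace ℝ (Fin p)}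

/-- The projection of an output vector onto the coordinates of the sensors `s`. -/
noncomputable def restrictCoords (s : Finset (Fin p)) :
    EuclideanSpace ℝ (Fin p) →L[ℝ] EuclideanSpace ℝ s :=
  LinearMap.toContinuousLinearMap
    { toFun := fun z => WithLp.toLp 2 fun i : s => z i
      map_add' := fun _ _ => rfl
      map_smul' := fun _ _ => rfl }

theorem restrictCoords_apply (s : Finset (Fin p)) (z : EuclideanSpace ℝ (Fin p)) (i : s) :
    restrictCoords s z i = z i :=
  rfl

theorem rows_toEuclideanLin (s : Finset (Fin p)) (z : EuclideanSpace ℝ (Fin n)) :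
    (S.rows s).toEuclideanLin z = restrictCoords s (S.C.toEuclideanLin z) := by
  ext i
  simp [restrictCoords_apply, rows, Matrix.toLpLin_apply, Matrix.mulVec, dotProduct]

/-- The information in the outputs `y(0), …, y(t-1)` of the sensors `s`. -/
noncomputable abbrev sensorHistory (s : Finset (Fin p)) (y : ℕ → Ω → EuclideanSpace ℝ (Fin p))
    (t : ℕ) : MeasurableSpace Ω :=
  ⨆ t' < t, MeasurableSpace.comap (fun ω => restrictCoords s (y t' ω)) inferInstance

theorem measurable_restrictCoords_sensorHistory {t' t : ℕ} (h : t' < t) :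
    Measurable[sensorHistory s y t] fun ω => restrictCoords s (y t' ω) :=
  Measurable.of_comap_le (le_iSup₂_of_le t' h le_rfl)

theorem measurable_kalman (S : LinSys n p) (s : Finset (Fin p))
    (y : ℕ → Ω → EuclideanSpace ℝ (Fin p)) (t : ℕ) :
    Measurable[sensorHistory s y t] (S.kalman s y t) := by
  induction t with
  | zero => exact measurable_const
  | succ t ih =>
    have hk : Measurable[sensorHistory s y (t + 1)] (S.kalman s y t) :=
      ih.mono (biSup_mono fun _ h => h.trans t.lt_succ_self) le_rfl
    exact ((measurable_toEuclideanLin S.A).comp hk).add ((measurable_toEuclideanLin _).comp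
      ((measurable_restrictCoords_sensorHistory t.lt_succ_self).sub
        ((measurable_toEuclideanLin _).comp hk)))

/-- The error `x(t) - x̂(t)` of the Kalman filter for the sensors `s` on attack-free outputs. -/
noncomputable def predError (S : LinSys n p) (x : ℕ → Ω → EuclideanSpace ℝ (Fin n))
    (v : ℕ → Ω → EuclideanSpace ℝ (Fin p)) (s : Finset (Fin p)) (t : ℕ) (ω : Ω) :
    EuclideanSpace ℝ (Fin n) :=
  x t ω - S.kalman s (S.cleanOutput x v) t ω

/-- The error `x(t+1) - A x̂(t)` of the prediction that ignores the outputs at time `t`. -/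
noncomputable def openLoopError (S : LinSys n p) (x : ℕ → Ω → EuclideanSpace ℝ (Fin n))
    (v : ℕ → Ω → EuclideanSpace ℝ (Fin p)) (s : Finset (Fin p)) (t : ℕ) (ω : Ω) :
    EuclideanSpace ℝ (Fin n) :=
  x (t + 1) ω - S.A.toEuclideanLin (S.kalman s (S.cleanOutput x v) t ω)

/-- The innovation of the Kalman filter for the sensors `s` on attack-free outputs: the outputs
at time `t` minus their prediction. -/
noncomputable def innovation (S : LinSys n p) (x : ℕ → Ω → EuclideanSpace ℝ (Fin n))
    (v : ℕ → Ω → EuclideanSpace ℝ (Fin p)) (s : Finset (Fin p)) (t : ℕ) (ω : Ω) :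
    EuclideanSpace ℝ s :=
  restrictCoords s (S.cleanOutput x v t ω) -
    (S.rows s).toEuclideanLin (S.kalman s (S.cleanOutput x v) t ω)

theorem predError_succ (t : ℕ) : S.predError x v s (t + 1) = fun ω =>
    S.openLoopError x v s t ω -
      (S.gain s (S.riccati s t)).toEuclideanLin (S.innovation x v s t ω) :=
  funext fun _ => (sub_sub _ _ _).symm

theorem openLoopError_eq
    (hx : ∀ t ω, x (t + 1) ω = S.A.toEuclideanLin (x t ω) + w t ω) (t : ℕ) :
    S.openLoopError x v s t = fun ω => S.A.toEuclideanLin (S.predError x v s t ω) + w t ω := by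
  ext1 ω
  rw [openLoopError, hx, predError, map_sub]
  abel

theorem innovation_eq (t : ℕ) : S.innovation x v s t = fun ω =>
    (S.rows s).toEuclideanLin (S.predError x v s t ω) + restrictCoords s (v t ω) := by
  ext1 ω
  rw [innovation, predError, cleanOutput, map_sub, map_add, rows_toEuclideanLin s (x t ω)]
  abel

theorem measurable_innovation {m : MeasurableSpace Ω} {t : ℕ}
    (he : Measurable[m] (S.predError x v s t)) (hv : Measurable[m] (v t)) :
    Measurable[m] (S.innovation x v s t) := by
  rw [innovation_eq t]
  exact ((measurable_toEuclideanLin _).comp he).add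
    ((restrictCoords s).continuous.measurable.comp hv)

theorem measurable_predError_succ {m : MeasurableSpace Ω}
    (hx : ∀ t ω, x (t + 1) ω = S.A.toEuclideanLin (x t ω) + w t ω) {t : ℕ}
    (he : Measurable[m] (S.predError x v s t)) (hw : Measurable[m] (w t))
    (hv : Measurable[m] (v t)) : Measurable[m] (S.predError x v s (t + 1)) := by
  rw [predError_succ t, openLoopError_eq hx t]
  exact (((measurable_toEuclideanLin S.A).comp he).add hw).sub
    ((measurable_toEuclideanLin _).comp (measurable_innovation he hv))

theorem sensorHistory_succ_le (t : ℕ) :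
    sensorHistory s (S.cleanOutput x v) (t + 1) ≤
      MeasurableSpace.comap (S.innovation x v s t) inferInstance ⊔
        sensorHistory s (S.cleanOutput x v) t := by
  refine iSup₂_le fun t' ht' => ?_
  rcases Nat.lt_succ_iff_lt_or_eq.mp ht' with hlt | rfl
  · exact (measurable_restrictCoords_sensorHistory hlt).comap_le.trans le_sup_right
  · have hsum : (fun ω => restrictCoords s (S.cleanOutput x v t' ω)) = fun ω =>
        S.innovation x v s t' ω +
          (S.rows s).toEuclideanLin (S.kalman s (S.cleanOutput x v) t' ω) :=
      funext fun _ => (sub_add_cancel _ _).symm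
    rw [hsum, ← measurable_iff_comap_le]
    exact (Measurable.of_comap_le le_sup_left).add ((measurable_toEuclideanLin _).comp
      ((measurable_kalman S s _ t').mono le_sup_right le_rfl))

theorem gain_mul (s : Finset (Fin p)) (hσv : S.σv ≠ 0) {P : Matrix (Fin n) (Fin n) ℝ}
    (hP : P.PosSemidef) :
    S.gain s P * (S.rows s * P * (S.rows s).transpose + S.σv ^ 2 • (1 : Matrix s s ℝ)) =
      S.A * P * (S.rows s).transpose := by
  have hsignal : (S.rows s * P * (S.rows s).transpose).PosSemidef := by
    simpa only [Matrix.conjTranspose_eq_transpose_of_trivial] using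
      hP.mul_mul_conjTranspose_same (S.rows s)
  have hnoise : (S.σv ^ 2 • (1 : Matrix s s ℝ)).PosDef := Matrix.PosDef.one.smul (by positivity)
  have hdet := (Matrix.isUnit_iff_isUnit_det _).mp (hnoise.posSemidef_add hsignal).isUnit
  rw [gain, Matrix.mul_assoc, Matrix.nonsing_inv_mul _ hdet, Matrix.mul_one]

end Filter

section Randomness

variable {n p : ℕ} {Ω : Type*} {x w : ℕ → Ω → EuclideanSpace ℝ (Fin n)}
  {v : ℕ → Ω → EuclideanSpace ℝ (Fin p)}

/-- The σ-algebras generated by the independent sources of randomness: `x(0)`, the `w(t)` and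
the `v(t)`. -/
abbrev primitiveSigma (x w : ℕ → Ω → EuclideanSpace ℝ (Fin n))
    (v : ℕ → Ω → EuclideanSpace ℝ (Fin p)) : Unit ⊕ ℕ ⊕ ℕ → MeasurableSpace Ω :=
  Sum.elim (fun _ => MeasurableSpace.comap (x 0) inferInstance)
    (Sum.elim (fun t => MeasurableSpace.comap (w t) inferInstance)
      fun t => MeasurableSpace.comap (v t) inferInstance)

/-- The first time at which a source of randomness belongs to the past: `x(0)` does from the
beginning, `w(t)` and `v(t)` from time `t + 1` on. -/
def arrivalTime : Unit ⊕ ℕ ⊕ ℕ → ℕ :=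
  Sum.elim (fun _ => 0) (Sum.elim Nat.succ Nat.succ)

/-- The information in `x(0)` and in the noises before time `t`. -/
abbrev past (x w : ℕ → Ω → EuclideanSpace ℝ (Fin n)) (v : ℕ → Ω → EuclideanSpace ℝ (Fin p))
    (t : ℕ) : MeasurableSpace Ω :=
  ⨆ i ∈ {i | arrivalTime i ≤ t}, primitiveSigma x w v i

/-- The information in the noises from time `t` on. -/
abbrev future (x w : ℕ → Ω → EuclideanSpace ℝ (Fin n)) (v : ℕ → Ω → EuclideanSpace ℝ (Fin p))
    (t : ℕ) : MeasurableSpace Ω :=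
  ⨆ i ∈ {i | t < arrivalTime i}, primitiveSigma x w v i

theorem past_mono : Monotone (past x w v) :=
  fun _ _ h => biSup_mono fun _ hi => le_trans hi h

theorem measurable_init_past (t : ℕ) : Measurable[past x w v t] (x 0) :=
  Measurable.of_comap_le (le_iSup₂_of_le (.inl ()) (Nat.zero_le t) le_rfl)

theorem measurable_w_past {t' t : ℕ} (h : t' < t) : Measurable[past x w v t] (w t') :=
  Measurable.of_comap_le (le_iSup₂_of_le (.inr (.inl t')) (Nat.succ_le_of_lt h) le_rfl)

theorem measurable_v_past {t' t : ℕ} (h : t' < t) : Measurable[past x w v t] (v t') :=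
  Measurable.of_comap_le (le_iSup₂_of_le (.inr (.inr t')) (Nat.succ_le_of_lt h) le_rfl)

theorem measurable_w_future {t t' : ℕ} (h : t ≤ t') : Measurable[future x w v t] (w t') :=
  Measurable.of_comap_le (le_iSup₂_of_le (.inr (.inl t')) (Nat.lt_succ_of_le h) le_rfl)

theorem measurable_v_future {t t' : ℕ} (h : t ≤ t') : Measurable[future x w v t] (v t') :=
  Measurable.of_comap_le (le_iSup₂_of_le (.inr (.inr t')) (Nat.lt_succ_of_le h) le_rfl)

theorem comap_predError_succ_sup_comap_innovation_le {S : LinSys n p} {s : Finset (Fin p)}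
    (hx : ∀ t ω, x (t + 1) ω = S.A.toEuclideanLin (x t ω) + w t ω) (t : ℕ) :
    MeasurableSpace.comap (S.predError x v s (t + 1)) inferInstance ⊔
        MeasurableSpace.comap (S.innovation x v s t) inferInstance ≤
      MeasurableSpace.comap (S.predError x v s t) inferInstance ⊔ future x w v t := by
  let m := MeasurableSpace.comap (S.predError x v s t) inferInstance ⊔ future x w v t
  have he : Measurable[m] (S.predError x v s t) := Measurable.of_comap_le le_sup_left
  have hw : Measurable[m] (w t) := (measurable_w_future le_rfl).mono le_sup_right le_rfl
  have hv : Measurable[m] (v t) := (measurable_v_future le_rfl).mono le_sup_right le_rfl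
  exact sup_le (measurable_predError_succ hx he hw hv).comap_le
    (measurable_innovation he hv).comap_le

end Randomness

namespace IsRealization

variable {n p : ℕ} {Ω : Type*} [mΩ : MeasurableSpace Ω] {S : LinSys n p} {μ : Measure Ω}
  {x w : ℕ → Ω → EuclideanSpace ℝ (Fin n)} {v : ℕ → Ω → EuclideanSpace ℝ (Fin p)}

section Measurability

theorem primitiveSigma_le (hS : S.IsRealization μ x w v) (i : Unit ⊕ ℕ ⊕ ℕ) :
    primitiveSigma x w v i ≤ mΩ := by
  rcases i with _ | t | t
  · exact hS.measurable_init.comap_le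
  · exact (hS.measurable_w t).comap_le
  · exact (hS.measurable_v t).comap_le

theorem past_le (hS : S.IsRealization μ x w v) (t : ℕ) : past x w v t ≤ mΩ :=
  iSup₂_le fun i _ => hS.primitiveSigma_le i

theorem future_le (hS : S.IsRealization μ x w v) (t : ℕ) : future x w v t ≤ mΩ :=
  iSup₂_le fun i _ => hS.primitiveSigma_le i

theorem measurable_state_past (hS : S.IsRealization μ x w v) (t : ℕ) :
    Measurable[past x w v t] (x t) := by
  induction t with
  | zero => exact measurable_init_past 0
  | succ t ih =>
    rw [funext (hS.dynamics t)]
    exact ((measurable_toEuclideanLin S.A).comp (ih.mono (past_mono t.le_succ) le_rfl)).add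
      (measurable_w_past t.lt_succ_self)

theorem measurable_cleanOutput_past (hS : S.IsRealization μ x w v) (t : ℕ) :
    Measurable[past x w v (t + 1)] (S.cleanOutput x v t) :=
  ((measurable_toEuclideanLin S.C).comp
    ((hS.measurable_state_past t).mono (past_mono t.le_succ) le_rfl)).add
      (measurable_v_past t.lt_succ_self)

theorem sensorHistory_le_past (hS : S.IsRealization μ x w v) (s : Finset (Fin p)) (t : ℕ) :
    sensorHistory s (S.cleanOutput x v) t ≤ past x w v t :=
  iSup₂_le fun t' ht' => ((restrictCoords s).continuous.measurable.comp
    ((hS.measurable_cleanOutput_past t').mono (past_mono ht') le_rfl)).comap_le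

theorem measurable_predError_past (hS : S.IsRealization μ x w v) (s : Finset (Fin p)) (t : ℕ) :
    Measurable[past x w v t] (S.predError x v s t) :=
  (hS.measurable_state_past t).sub
    ((measurable_kalman S s _ t).mono (hS.sensorHistory_le_past s t) le_rfl)

theorem measurable_predError (hS : S.IsRealization μ x w v) (s : Finset (Fin p)) (t : ℕ) :
    Measurable (S.predError x v s t) :=
  (hS.measurable_predError_past s t).mono (hS.past_le t) le_rfl

theorem measurable_innovation (hS : S.IsRealization μ x w v) (s : Finset (Fin p)) (t : ℕ) :
    Measurable (S.innovation x v s t) :=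
  LinSys.measurable_innovation (hS.measurable_predError s t) (hS.measurable_v t)

theorem integrable_state (hS : S.IsRealization μ x w v) (t : ℕ) : Integrable (x t) μ := by
  induction t with
  | zero => exact hS.law_init.hasGaussianLaw.integrable
  | succ t ih =>
    rw [funext (hS.dynamics t)]
    exact (S.A.toEuclideanLin.toContinuousLinearMap.integrable_comp ih).add
      (hS.law_w t).hasGaussianLaw.integrable

end Measurability

section Independence

theorem indepFun_w_v (hS : S.IsRealization μ x w v) (t : ℕ) : IndepFun (w t) (v t) μ :=
  hS.indep_wv.comp (measurable_pi_apply t) (measurable_pi_apply t)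

variable [IsProbabilityMeasure μ]

theorem iIndep_primitiveSigma (hS : S.IsRealization μ x w v) : iIndep (primitiveSigma x w v) μ := by
  have hwv : Indep (⨆ t, MeasurableSpace.comap (w t) inferInstance)
      (⨆ t, MeasurableSpace.comap (v t) inferInstance) μ := by
    have h := hS.indep_wv
    rwa [IndepFun_iff_Indep, MeasurableSpace.comap_process_pi,
      MeasurableSpace.comap_process_pi] at h
  have hinit : Indep (MeasurableSpace.comap (x 0) inferInstance)
      ((⨆ t, MeasurableSpace.comap (w t) inferInstance) ⊔
        ⨆ t, MeasurableSpace.comap (v t) inferInstance) μ := by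
    have h := hS.indep_init
    rwa [IndepFun_iff_Indep, Prod.instMeasurableSpace, MeasurableSpace.comap_prodMk,
      MeasurableSpace.comap_process_pi, MeasurableSpace.comap_process_pi] at h
  refine iIndep_sumElim iIndep.of_subsingleton (iIndep_sumElim hS.indep_w hS.indep_v hwv) ?_
  simpa only [iSup_unique, iSup_sum, Sum.elim_inl, Sum.elim_inr] using hinit

theorem indep_past_future (hS : S.IsRealization μ x w v) (t : ℕ) :
    Indep (past x w v t) (future x w v t) μ :=
  indep_iSup_of_disjoint hS.primitiveSigma_le hS.iIndep_primitiveSigma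
    (Set.disjoint_left.mpr fun _ (hpast : _ ≤ t) (hfuture : t < _) => hfuture.not_ge hpast)

theorem indepFun_predError_noise (hS : S.IsRealization μ x w v) (s : Finset (Fin p)) (t : ℕ) :
    IndepFun (S.predError x v s t) (fun ω => (w t ω, v t ω)) μ :=
  indep_of_indep_of_le_left
    (indep_of_indep_of_le_right (hS.indep_past_future t)
      ((measurable_w_future le_rfl).prodMk (measurable_v_future le_rfl)).comap_le)
    (hS.measurable_predError_past s t).comap_le

end Independence

section ErrorLaw

theorem crossCov_w (hS : S.IsRealization μ x w v) (t : ℕ) :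
    crossCov μ (w t) (w t) = S.σw ^ 2 • (1 : Matrix (Fin n) (Fin n) ℝ) :=
  crossCov_eq_of_hasLaw_multivariateGaussian (Matrix.PosSemidef.one.smul (sq_nonneg _)) (hS.law_w t)

theorem hasGaussianLaw_restrictCoords_v (hS : S.IsRealization μ x w v) (s : Finset (Fin p))
    (t : ℕ) : HasGaussianLaw (fun ω => restrictCoords s (v t ω)) μ :=
  (hS.law_v t).hasGaussianLaw.map_fun (restrictCoords s)

theorem crossCov_restrictCoords_v (hS : S.IsRealization μ x w v) (s : Finset (Fin p)) (t : ℕ) :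
    crossCov μ (fun ω => restrictCoords s (v t ω)) (fun ω => restrictCoords s (v t ω)) =
      S.σv ^ 2 • (1 : Matrix s s ℝ) := by
  have hv : crossCov μ (v t) (v t) = S.σv ^ 2 • (1 : Matrix (Fin p) (Fin p) ℝ) :=
    crossCov_eq_of_hasLaw_multivariateGaussian (Matrix.PosSemidef.one.smul (sq_nonneg _))
      (hS.law_v t)
  ext i j
  exact (congrFun (congrFun hv i) j).trans (by simp [Matrix.one_apply])

variable [IsProbabilityMeasure μ]

theorem hasGaussianLaw_openLoopError_innovation (hS : S.IsRealization μ x w v)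
    {s : Finset (Fin p)} {t : ℕ} (he : HasGaussianLaw (S.predError x v s t) μ) :
    HasGaussianLaw (fun ω => (S.openLoopError x v s t ω, S.innovation x v s t ω)) μ := by
  have hnoise : HasGaussianLaw (fun ω => (w t ω, v t ω)) μ :=
    (hS.indepFun_w_v t).hasGaussianLaw (hS.law_w t).hasGaussianLaw (hS.law_v t).hasGaussianLaw
  have hjoint : HasGaussianLaw (fun ω => (S.predError x v s t ω, (w t ω, v t ω))) μ :=
    (hS.indepFun_predError_noise s t).hasGaussianLaw he hnoise
  let L := S.A.toEuclideanLin.toContinuousLinearMap.coprod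
    (ContinuousLinearMap.fst ℝ (EuclideanSpace ℝ (Fin n)) (EuclideanSpace ℝ (Fin p)))
  let M := (S.rows s).toEuclideanLin.toContinuousLinearMap.coprod
    (restrictCoords s ∘L
      ContinuousLinearMap.snd ℝ (EuclideanSpace ℝ (Fin n)) (EuclideanSpace ℝ (Fin p)))
  rw [openLoopError_eq hS.dynamics t, innovation_eq t]
  exact hjoint.map_fun (L.prod M)

theorem hasGaussianLaw_predError (hS : S.IsRealization μ x w v) (s : Finset (Fin p)) (t : ℕ) :
    HasGaussianLaw (S.predError x v s t) μ := by
  induction t with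
  | zero => exact hasGaussianLaw_sub_const hS.law_init.hasGaussianLaw S.m₀
  | succ t ih =>
    rw [predError_succ t]
    exact (hasGaussianLaw_sub_toEuclideanLin_prodMk _
      (hS.hasGaussianLaw_openLoopError_innovation ih)).fst

theorem integral_predError (hS : S.IsRealization μ x w v) (s : Finset (Fin p)) (t : ℕ) :
    ∫ ω, S.predError x v s t ω ∂μ = 0 := by
  induction t with
  | zero =>
    calc ∫ ω, x 0 ω - S.m₀ ∂μ = S.m₀ - S.m₀ := by
          rw [integral_sub hS.law_init.hasGaussianLaw.integrable (integrable_const _),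
            integral_eq_of_hasLaw_multivariateGaussian hS.law_init, integral_const,
            probReal_univ, one_smul]
      _ = 0 := sub_self _
  | succ t ih =>
    have he := hS.hasGaussianLaw_predError s t
    have hjoint := hS.hasGaussianLaw_openLoopError_innovation he
    have hopen : ∫ ω, S.openLoopError x v s t ω ∂μ = 0 := by
      rw [openLoopError_eq hS.dynamics t, integral_add (integrable_toEuclideanLin _ he.integrable)
          (hS.law_w t).hasGaussianLaw.integrable, integral_toEuclideanLin _ he.integrable, ih,
        integral_eq_of_hasLaw_multivariateGaussian (hS.law_w t), map_zero, add_zero]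
    have hinnov : ∫ ω, S.innovation x v s t ω ∂μ = 0 := by
      rw [innovation_eq t, integral_add (integrable_toEuclideanLin _ he.integrable)
          (hS.hasGaussianLaw_restrictCoords_v s t).integrable,
        integral_toEuclideanLin _ he.integrable, ih,
        (restrictCoords s).integral_comp_comm (hS.law_v t).hasGaussianLaw.integrable,
        integral_eq_of_hasLaw_multivariateGaussian (hS.law_v t), map_zero, map_zero, add_zero]
    rw [predError_succ t, integral_sub hjoint.fst.integrable
        (integrable_toEuclideanLin _ hjoint.snd.integrable),
      integral_toEuclideanLin _ hjoint.snd.integrable, hopen, hinnov, map_zero, sub_zero]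

theorem crossCov_predError_w (hS : S.IsRealization μ x w v) (s : Finset (Fin p)) (t : ℕ) :
    crossCov μ (S.predError x v s t) (w t) = 0 :=
  crossCov_eq_zero_of_indepFun (hS.hasGaussianLaw_predError s t).memLp_two
    (hS.law_w t).hasGaussianLaw.memLp_two
    ((hS.indepFun_predError_noise s t).comp measurable_id measurable_fst)

theorem crossCov_predError_restrictCoords_v (hS : S.IsRealization μ x w v) (s : Finset (Fin p))
    (t : ℕ) : crossCov μ (S.predError x v s t) (fun ω => restrictCoords s (v t ω)) = 0 :=
  crossCov_eq_zero_of_indepFun (hS.hasGaussianLaw_predError s t).memLp_two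
    (hS.hasGaussianLaw_restrictCoords_v s t).memLp_two
    ((hS.indepFun_predError_noise s t).comp measurable_id
      ((restrictCoords s).continuous.measurable.comp measurable_snd))

theorem crossCov_openLoopError_self (hS : S.IsRealization μ x w v) (s : Finset (Fin p)) (t : ℕ) :
    crossCov μ (S.openLoopError x v s t) (S.openLoopError x v s t) =
      S.A * crossCov μ (S.predError x v s t) (S.predError x v s t) * S.A.transpose +
        S.σw ^ 2 • (1 : Matrix (Fin n) (Fin n) ℝ) := by
  have hw := (hS.law_w t).hasGaussianLaw.memLp_two
  have hew := hS.crossCov_predError_w s t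
  rw [openLoopError_eq hS.dynamics t, crossCov_toEuclideanLin_add_toEuclideanLin_add _ _
    (hS.hasGaussianLaw_predError s t).memLp_two hw hw hew hew, hS.crossCov_w t]

theorem crossCov_innovation_self (hS : S.IsRealization μ x w v) (s : Finset (Fin p)) (t : ℕ) :
    crossCov μ (S.innovation x v s t) (S.innovation x v s t) =
      S.rows s * crossCov μ (S.predError x v s t) (S.predError x v s t) * (S.rows s).transpose +
        S.σv ^ 2 • (1 : Matrix s s ℝ) := by
  have hv := (hS.hasGaussianLaw_restrictCoords_v s t).memLp_two
  have hev := hS.crossCov_predError_restrictCoords_v s t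
  rw [innovation_eq t, crossCov_toEuclideanLin_add_toEuclideanLin_add _ _
    (hS.hasGaussianLaw_predError s t).memLp_two hv hv hev hev, hS.crossCov_restrictCoords_v s t]

theorem crossCov_openLoopError_innovation (hS : S.IsRealization μ x w v) (s : Finset (Fin p))
    (t : ℕ) : crossCov μ (S.openLoopError x v s t) (S.innovation x v s t) =
      S.A * crossCov μ (S.predError x v s t) (S.predError x v s t) * (S.rows s).transpose := by
  have hw := (hS.law_w t).hasGaussianLaw.memLp_two
  have hv := (hS.hasGaussianLaw_restrictCoords_v s t).memLp_two
  have hwv : crossCov μ (w t) (fun ω => restrictCoords s (v t ω)) = 0 :=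
    crossCov_eq_zero_of_indepFun hw hv
      ((hS.indepFun_w_v t).comp measurable_id (restrictCoords s).continuous.measurable)
  rw [openLoopError_eq hS.dynamics t, innovation_eq t,
    crossCov_toEuclideanLin_add_toEuclideanLin_add _ _
      (hS.hasGaussianLaw_predError s t).memLp_two hw hv (hS.crossCov_predError_w s t)
      (hS.crossCov_predError_restrictCoords_v s t), hwv, add_zero]

theorem gain_mul_crossCov_innovation (hS : S.IsRealization μ x w v) (hσv : S.σv ≠ 0)
    (s : Finset (Fin p)) (t : ℕ) :
    S.gain s (crossCov μ (S.predError x v s t) (S.predError x v s t)) *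
        crossCov μ (S.innovation x v s t) (S.innovation x v s t) =
      crossCov μ (S.openLoopError x v s t) (S.innovation x v s t) := by
  rw [hS.crossCov_innovation_self, hS.crossCov_openLoopError_innovation,
    gain_mul s hσv (crossCov_self_posSemidef (hS.hasGaussianLaw_predError s t).memLp_two)]

theorem crossCov_predError (hS : S.IsRealization μ x w v) (hσv : S.σv ≠ 0)
    (hP₀ : S.P₀.PosSemidef) (s : Finset (Fin p)) (t : ℕ) :
    crossCov μ (S.predError x v s t) (S.predError x v s t) = S.riccati s t := by
  induction t with
  | zero =>
    exact (crossCov_sub_const_self hS.law_init.hasGaussianLaw.integrable S.m₀).trans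
      (crossCov_eq_of_hasLaw_multivariateGaussian hP₀ hS.law_init)
  | succ t ih =>
    have hjoint := hS.hasGaussianLaw_openLoopError_innovation (hS.hasGaussianLaw_predError s t)
    have hgain := hS.gain_mul_crossCov_innovation hσv s t
    rw [ih] at hgain
    rw [predError_succ t, crossCov_sub_toEuclideanLin_self hjoint.fst.memLp_two
        hjoint.snd.memLp_two hgain, hS.crossCov_openLoopError_self,
      ← crossCov_transpose (S.openLoopError x v s t), hS.crossCov_openLoopError_innovation,
      Matrix.transpose_mul, Matrix.transpose_mul, Matrix.transpose_transpose, crossCov_transpose,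
      ih]
    simp only [riccati, Matrix.mul_assoc]

theorem indepFun_predError_succ_innovation (hS : S.IsRealization μ x w v) (hσv : S.σv ≠ 0)
    (hP₀ : S.P₀.PosSemidef) (s : Finset (Fin p)) (t : ℕ) :
    IndepFun (S.predError x v s (t + 1)) (S.innovation x v s t) μ := by
  rw [predError_succ t, ← hS.crossCov_predError hσv hP₀]
  exact indepFun_sub_toEuclideanLin
    (hS.hasGaussianLaw_openLoopError_innovation (hS.hasGaussianLaw_predError s t))
    (hS.gain_mul_crossCov_innovation hσv s t)

end ErrorLaw

section Estimation

variable [IsProbabilityMeasure μ]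

theorem indep_sensorHistory_predError_sup_future (hS : S.IsRealization μ x w v)
    {s : Finset (Fin p)} {t : ℕ}
    (h : Indep (MeasurableSpace.comap (S.predError x v s t) inferInstance)
      (sensorHistory s (S.cleanOutput x v) t) μ) :
    Indep (sensorHistory s (S.cleanOutput x v) t)
      (MeasurableSpace.comap (S.predError x v s t) inferInstance ⊔ future x w v t) μ := by
  have hhist := hS.sensorHistory_le_past s t
  have herr := (hS.measurable_predError_past s t).comap_le
  exact indep_sup_right_of_indep_sup_left (hhist.trans (hS.past_le t)) (herr.trans (hS.past_le t))
    (hS.future_le t) h.symm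
    (indep_of_indep_of_le_left (hS.indep_past_future t) (sup_le hhist herr))

theorem indep_predError_sensorHistory (hS : S.IsRealization μ x w v) (hσv : S.σv ≠ 0)
    (hP₀ : S.P₀.PosSemidef) (s : Finset (Fin p)) (t : ℕ) :
    Indep (MeasurableSpace.comap (S.predError x v s t) inferInstance)
      (sensorHistory s (S.cleanOutput x v) t) μ := by
  induction t with
  | zero =>
    simpa only [sensorHistory, Nat.not_lt_zero, iSup_false, iSup_bot] using indep_bot_right _
  | succ t ih =>
    -- `e(t+1)` and the innovation are functions of `e(t)` and fresh noise, so jointly independent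
    -- of the history; being independent of each other too, the innovation can join the history.
    have hpair : Indep (MeasurableSpace.comap (S.predError x v s (t + 1)) inferInstance ⊔
        MeasurableSpace.comap (S.innovation x v s t) inferInstance)
        (sensorHistory s (S.cleanOutput x v) t) μ :=
      indep_of_indep_of_le_left (hS.indep_sensorHistory_predError_sup_future ih).symm
        (comap_predError_succ_sup_comap_innovation_le hS.dynamics t)
    exact indep_of_indep_of_le_right
      (indep_sup_right_of_indep_sup_left (hS.measurable_predError s (t + 1)).comap_le
        (hS.measurable_innovation s t).comap_le
        ((hS.sensorHistory_le_past s t).trans (hS.past_le t))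
        (hS.indepFun_predError_succ_innovation hσv hP₀ s t) hpair)
      (sensorHistory_succ_le t)

theorem condExp_state_ae_eq_kalman (hS : S.IsRealization μ x w v) (hσv : S.σv ≠ 0)
    (hP₀ : S.P₀.PosSemidef) (s : Finset (Fin p)) (t : ℕ) :
    μ[x t | sensorHistory s (S.cleanOutput x v) t] =ᵐ[μ] S.kalman s (S.cleanOutput x v) t := by
  have hsplit : x t = S.predError x v s t + S.kalman s (S.cleanOutput x v) t :=
    funext fun _ => (sub_add_cancel _ _).symm
  have he := (hS.hasGaussianLaw_predError s t).integrable
  have hk : Integrable (S.kalman s (S.cleanOutput x v) t) μ := by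
    rw [← add_sub_cancel_left (S.predError x v s t) (S.kalman s (S.cleanOutput x v) t), ← hsplit]
    exact (hS.integrable_state t).sub he
  conv_lhs => rw [hsplit]
  exact condExp_add_ae_eq_of_indep ((hS.sensorHistory_le_past s t).trans (hS.past_le t))
    (hS.measurable_predError s t) he
    (hS.integral_predError s t) (hS.indep_predError_sensorHistory hσv hP₀ s t)
    (measurable_kalman S s _ t) hk

end Estimation

end IsRealization

section ZeroingAttack

variable {n p : ℕ} {Ω : Type*} {S : LinSys n p} {s : Finset (Fin p)}
  {x : ℕ → Ω → EuclideanSpace ℝ (Fin n)} {v : ℕ → Ω → EuclideanSpace ℝ (Fin p)}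

/-- The attack that replaces the outputs of all sensors outside `s` by zero. -/
noncomputable def zeroingAttack (S : LinSys n p) (x : ℕ → Ω → EuclideanSpace ℝ (Fin n))
    (v : ℕ → Ω → EuclideanSpace ℝ (Fin p)) (s : Finset (Fin p)) (t : ℕ) (ω : Ω) :
    EuclideanSpace ℝ (Fin p) :=
  WithLp.toLp 2 fun j => if j ∈ s then 0 else -S.cleanOutput x v t ω j

theorem output_zeroingAttack_apply (t : ℕ) (ω : Ω) (j : Fin p) :
    S.output x v (S.zeroingAttack x v s) t ω j =
      if j ∈ s then S.cleanOutput x v t ω j else 0 := by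
  by_cases hj : j ∈ s <;> simp [output, zeroingAttack, hj]

theorem comap_output_zeroingAttack (t : ℕ) :
    MeasurableSpace.comap (S.output x v (S.zeroingAttack x v s) t) inferInstance =
      MeasurableSpace.comap (fun ω => restrictCoords s (S.cleanOutput x v t ω)) inferInstance := by
  refine le_antisymm ?_ ?_
  · let extend : EuclideanSpace ℝ s → EuclideanSpace ℝ (Fin p) := fun z =>
      WithLp.toLp 2 fun j => if hj : j ∈ s then z ⟨j, hj⟩ else 0
    have hextend : Measurable extend := (WithLp.measurable_toLp 2 (Fin p → ℝ)).comp <|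
      measurable_pi_lambda _ fun j => by split_ifs <;> fun_prop
    have houtput : S.output x v (S.zeroingAttack x v s) t =
        fun ω => extend (restrictCoords s (S.cleanOutput x v t ω)) := by
      ext ω j
      rw [output_zeroingAttack_apply]
      rfl
    rw [houtput]
    exact (hextend.comp (comap_measurable _)).comap_le
  · have hrestrict : (fun ω => restrictCoords s (S.cleanOutput x v t ω)) =
        fun ω => restrictCoords s (S.output x v (S.zeroingAttack x v s) t ω) := by
      ext ω i
      rw [restrictCoords_apply, restrictCoords_apply, output_zeroingAttack_apply, if_pos i.2]
    rw [hrestrict]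
    exact ((restrictCoords s).continuous.measurable.comp (comap_measurable _)).comap_le

theorem measurable_zeroingAttack {m : MeasurableSpace Ω} {t : ℕ}
    (h : Measurable[m] (S.cleanOutput x v t)) : Measurable[m] (S.zeroingAttack x v s t) :=
  (WithLp.measurable_toLp 2 (Fin p → ℝ)).comp <| measurable_pi_lambda _ fun j => by
    split_ifs <;> fun_prop

end ZeroingAttack

section Impossibility

variable {n p : ℕ} {Ω : Type*} [MeasurableSpace Ω] {S : LinSys n p} {μ : Measure Ω}
  {x w : ℕ → Ω → EuclideanSpace ℝ (Fin n)} {v : ℕ → Ω → EuclideanSpace ℝ (Fin p)}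
  {s : Finset (Fin p)}

theorem IsSteadyStateCov.eventually_sub_le_trace {P : Matrix (Fin n) (Fin n) ℝ}
    (h : S.IsSteadyStateCov μ x v s P) :
    ∀ ε > 0, ∀ᶠ t in atTop, P.trace - ε ≤ (S.kalmanCov μ x v s t).trace := by
  intro ε hε
  have htrace : Tendsto (fun t => (S.kalmanCov μ x v s t).trace) atTop (𝓝 P.trace) :=
    ((continuous_id.matrix_trace).tendsto P).comp h
  exact htrace.eventually_const_le (sub_lt_self _ hε)

variable [IsProbabilityMeasure μ]

theorem IsRealization.isKAttack_zeroingAttack (hS : S.IsRealization μ x w v) {k : ℕ}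
    (hs : s.card + k = p) : S.IsKAttack μ x w v k sᶜ (S.zeroingAttack x v s) where
  card_eq := by rw [Finset.card_compl, Fintype.card_fin]; omega
  attack_free j hj t ω := if_pos (Finset.notMem_compl.mp hj)
  causal := by
    refine ⟨⟨fun t => past x w v (t + 1), fun _ _ h => past_mono (Nat.succ_le_succ h),
      fun t => hS.past_le (t + 1)⟩, fun t => ?_, fun j _ t => ?_, fun t => ?_, fun i _ t => ?_⟩
    · exact measurable_zeroingAttack (hS.measurable_cleanOutput_past t)
    · exact Measurable.comp (g := fun y : EuclideanSpace ℝ (Fin p) => y j) (by fun_prop)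
        (hS.measurable_cleanOutput_past t)
    · exact indep_of_indep_of_le_right (hS.indep_past_future (t + 1))
        (iSup₂_le fun t' ht' => (measurable_w_future ht').comap_le)
    · exact indep_of_indep_of_le_right (hS.indep_past_future (t + 1))
        (iSup₂_le fun t' ht' => (Measurable.comp (g := fun y : EuclideanSpace ℝ (Fin p) => y i)
          (by fun_prop) (measurable_v_future ht')).comap_le)

theorem IsRealization.errCov_oracle_zeroingAttack (hS : S.IsRealization μ x w v)
    (hσv : S.σv ≠ 0) (hP₀ : S.P₀.PosSemidef) (s : Finset (Fin p)) (t : ℕ) :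
    errCov μ (x t) (oracle μ x (S.output x v (S.zeroingAttack x v s)) t) =
      S.kalmanCov μ x v s t := by
  have horacle : oracle μ x (S.output x v (S.zeroingAttack x v s)) t =ᵐ[μ]
      S.kalman s (S.cleanOutput x v) t := by
    simpa only [oracle, comap_output_zeroingAttack] using hS.condExp_state_ae_eq_kalman hσv hP₀ s t
  ext i j
  refine integral_congr_ae ?_
  filter_upwards [horacle] with ω hω
  rw [hω]

end Impossibility

end LinSys

theorem theorem1_general {n p : ℕ} (S : LinSys n p) (hσv : S.σv ≠ 0) (hP₀ : S.P₀.PosSemidef)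
    {Ω : Type*} [MeasurableSpace Ω] (μ : Measure Ω) [IsProbabilityMeasure μ]
    (x w : ℕ → Ω → EuclideanSpace ℝ (Fin n)) (v : ℕ → Ω → EuclideanSpace ℝ (Fin p))
    (hS : S.IsRealization μ x w v) (k : ℕ) (s : Finset (Fin p)) (hs : s.card + k = p) :
    ∃ a : ℕ → Ω → EuclideanSpace ℝ (Fin p), S.IsKAttack μ x w v k sᶜ a ∧
      (∀ j ∈ sᶜ, ∀ t ω, S.output x v a t ω j = 0) ∧
      ∀ t, LinSys.errCov μ (x t) (LinSys.oracle μ x (S.output x v a) t) =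
        S.kalmanCov μ x v s t :=
  ⟨S.zeroingAttack x v s, hS.isKAttack_zeroingAttack hs,
    fun j hj t ω => (LinSys.output_zeroingAttack_apply t ω j).trans
      (if_neg (Finset.mem_compl.mp hj)),
    hS.errCov_oracle_zeroingAttack hσv hP₀ s⟩

theorem theorem1 {n p : ℕ} (S : LinSys n p) (hσw : 0 ≤ S.σw) (hσv : 0 < S.σv)
    (hP₀ : S.P₀.PosSemidef)
    {Ω : Type*} [MeasurableSpace Ω] (μ : Measure Ω) [IsProbabilityMeasure μ]
    (x w : ℕ → Ω → EuclideanSpace ℝ (Fin n)) (v : ℕ → Ω → EuclideanSpace ℝ (Fin p))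
    (hS : S.IsRealization μ x w v)
    (k : ℕ) (hk : k ≤ p)
    -- the steady-state Kalman error covariances of the sensor sets of size `p - k`
    (Pstar : Finset (Fin p) → Matrix (Fin n) (Fin n) ℝ)
    (hPstar : ∀ s : Finset (Fin p), s.card = p - k → S.IsSteadyStateCov μ x v s (Pstar s))
    -- a worst-case sensor set of size `p - k`
    (sworst : Finset (Fin p)) (hcard : sworst.card = p - k)
    (hworst : ∀ s : Finset (Fin p), s.card = p - k → (Pstar s).trace ≤ (Pstar sworst).trace) :
    ∃ (κ : Finset (Fin p)) (a : ℕ → Ω → EuclideanSpace ℝ (Fin p)),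
      S.IsKAttack μ x w v k κ a ∧
      (∀ j ∈ κ, ∀ t ω, S.output x v a t ω j = 0) ∧
      -- the bound at every time at which the worst-case filter is in steady state
      (∀ t, S.kalmanCov μ x v sworst t = Pstar sworst →
        (Pstar sworst).trace ≤
          (LinSys.errCov μ (x t) (LinSys.oracle μ x (S.output x v a) t)).trace) ∧
      -- the bound in the limit, without that proviso
      (∀ ε > 0, ∀ᶠ t in atTop,
        (Pstar sworst).trace - ε ≤
          (LinSys.errCov μ (x t) (LinSys.oracle μ x (S.output x v a) t)).trace) := by
  obtain ⟨a, ha, hzero, hcov⟩ :=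
    theorem1_general S hσv.ne' hP₀ μ x w v hS k sworst (by omega)
  exact ⟨sworstᶜ, a, ha, hzero, fun t ht => by rw [hcov, ht],
    by simpa only [hcov] using (hPstar sworst hcard).eventually_sub_le_trace⟩
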